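/- All graphs are finite and simple. Write $S(r)=K_{1,r}$ for the star with $r$ edges, $jK_2$ for the disjoint union of $j$ copies of $K_2$ (a graph isomorphic to some $jK_2$ is called a matching), and $X\cup Y$ for the disjoint union of graphs. Write $F\to(G,H)$ if every red-blue coloring of the edges of $F$ contains a red copy of $G$ or a blue copy of $H$ (copies need not be induced). A graph $F$ is Ramsey-minimal for $(G,H)$ if $F\to(G,H)$ but $F'\not\to(G,H)$ for every proper subgraph $F'$ of $F$; let $\mathcal R(G,H)$ be the set of isomorphism classes of Ramsey-minimal graphs for $(G,H)$. The set $\mathcal R\bigl(S(5)\cup S(2),\,S(3)\cup 122K_2\bigr)$ is finite, neither $S(5)\cup S(2)$ nor $S(3)\cup 122K_2$ is a matching, and $S(5)\cup S(2)$ is not isomorphic to $S(r)\cup qK_2$ for any integers $r,q\ge 0$. Moreover, Burr's 1979 conjecture is false, that is, the following does not hold: for all graphs $G$ and $H$ that have at least one edge and no isolated vertices, $\mathcal R(G,H)$ is finite if and only if either at least one of $G$ and $H$ is a matching, or each of $G$ and $H$ is of the form $S(r)\cup qK_2$ with $r$ a positive odd integer and $q\ge 0$ (where $r$ and $q$ may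 be different for $G$ and $H$). -/

import Mathlib

open SimpleGraph

namespace RamseyMin

/-- `S(r) = K_{1,r}`, the star with `r` edges. -/
abbrev starG (r : ℕ) : SimpleGraph (Fin 1 ⊕ Fin r) :=
  completeBipartiteGraph (Fin 1) (Fin r)

/-- `jK₂`, the disjoint union of `j` copies of `K₂`; the `i`-th copy has vertices
`(i, false)` and `(i, true)`. -/
def matchingG (j : ℕ) : SimpleGraph (Fin j × Bool) where
  Adj x y := x.1 = y.1 ∧ x.2 ≠ y.2
  symm := ⟨fun _ _ h => ⟨h.1.symm, h.2.symm⟩⟩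
  loopless := ⟨fun _ h => h.2 rfl⟩

/-- `F → (G, H)`. A red-blue coloring of the edges of `F` is given by its red graph `R ≤ F`;
the blue graph is then `F \ R`. Copies need not be induced. -/
def Arrows {U V W : Type*} (F : SimpleGraph U) (G : SimpleGraph V) (H : SimpleGraph W) : Prop :=
  ∀ R : SimpleGraph U, R ≤ F → G.IsContained R ∨ H.IsContained (F \ R)

/-- `F` is Ramsey-minimal for `(G, H)`: `F → (G, H)`, but no proper subgraph of `F`
(obtained by deleting edges, vertices, or both) has this property. -/
def IsRamseyMinimal {U V W : Type*} (F : SimpleGraph U) (G : SimpleGraph V)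
    (H : SimpleGraph W) : Prop :=
  Arrows F G H ∧ ∀ F' : F.Subgraph, F' ≠ ⊤ → ¬ Arrows F'.coe G H

/-- Isomorphism of finite graphs, each represented on a vertex set `Fin n`. -/
def graphSetoid : Setoid (Σ n : ℕ, SimpleGraph (Fin n)) where
  r A B := Nonempty (A.2 ≃g B.2)
  iseqv := ⟨fun _ => ⟨Iso.refl⟩, fun ⟨f⟩ => ⟨f.symm⟩, fun ⟨f⟩ ⟨g⟩ => ⟨f.trans g⟩⟩

/-- Isomorphism classes of finite graphs. -/
def GraphClass : Type := Quotient graphSetoid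

/-- The isomorphism class of a graph on `Fin n`. -/
def GraphClass.mk {n : ℕ} (F : SimpleGraph (Fin n)) : GraphClass :=
  Quotient.mk graphSetoid ⟨n, F⟩

/-- `𝓡(G, H)`: the isomorphism classes of the finite Ramsey-minimal graphs for `(G, H)`. -/
def ramseyFamily {V W : Type*} (G : SimpleGraph V) (H : SimpleGraph W) : Set GraphClass :=
  {c | ∃ (n : ℕ) (F : SimpleGraph (Fin n)), IsRamseyMinimal F G H ∧ c = GraphClass.mk F}

/-- The pair `(G, H)` is Ramsey-finite. -/
def RamseyFinite {V W : Type*} (G : SimpleGraph V) (H : SimpleGraph W) : Prop :=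
  (ramseyFamily G H).Finite

/-- `G` is a matching, i.e. isomorphic to some `jK₂`. -/
def IsMatchingGraph {V : Type*} (G : SimpleGraph V) : Prop :=
  ∃ j : ℕ, Nonempty (G ≃g matchingG j)

/-- `G` is of the form `S(r) ∪ qK₂`. -/
def IsStarUnionMatching {V : Type*} (G : SimpleGraph V) (r q : ℕ) : Prop :=
  Nonempty (G ≃g (starG r ⊕g matchingG q))

/-- The standing hypotheses on target graphs: at least one edge and no isolated vertices. -/
def IsTarget {V : Type*} (G : SimpleGraph V) : Prop :=
  G ≠ ⊥ ∧ ∀ v, ∃ w, G.Adj v w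

/-- Burr's conjecture: `𝓡(G, H)` is finite if and only if one of `G`, `H` is a matching or both
are of the form `S(r) ∪ qK₂` with `r` odd (`r` and `q` may differ for the two graphs). -/
def BurrConjecture : Prop :=
  ∀ (V W : Type) [Finite V] [Finite W] (G : SimpleGraph V) (H : SimpleGraph W),
    IsTarget G → IsTarget H →
    (RamseyFinite G H ↔
      (IsMatchingGraph G ∨ IsMatchingGraph H) ∨
      ((∃ r q : ℕ, Odd r ∧ IsStarUnionMatching G r q) ∧
        (∃ r q : ℕ, Odd r ∧ IsStarUnionMatching H r q)))

end RamseyMin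

/-!
Write `G = S(r) ∪ S(2)` and `H = S(s) ∪ kK₂` with `r > s > 1` odd and `k` large. It suffices to
bound the number of vertices of a graph `F` that is minimal for `(G, H)`; suppose `F` is huge.

The degrees of `F` are bounded, since a vertex with very many edges of one colour absorbs the
restored edge in a colouring of `F - e` that avoids `G` and `H`. As `F` has no isolated vertices
or edges, it contains a copy of `S(2)` away from any small set of vertices.

In such a colouring of `F - e` all red degrees are less than `r`. Suppose there is a red `S(r)`. A
blue `S(s)` would give a small set covering the blue edges, hence a red `S(2)` far away from both,
so the blue degrees are less than `s < r`. Then all vertices of degree at least `r` in `F`, except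
perhaps the ends of `e`, have red degree at least `3`. There are more than `k` of them, since
otherwise making red the edges between the other vertices would avoid `G` and `H`; for large `k`,
one of them is the centre of a red `S(2)` disjoint from a red `S(r)`.

Consequently every edge of `F` has an end of degree at least `r`, or else it could be restored in
red. Moreover some vertex `v` has degree at least `r + s - 1`: otherwise, `r` and `s` being odd,
an almost balanced orientation and Hall's theorem split `F` into two graphs of maximum degree less
than `r` and less than `s`. For `e` away from `v`, the blue degree of `v` is then at least `s`, so
a small set covers the blue edges, and every vertex of degree at least `r` lies near this set or
on `e`. Hence these vertices, which cover the edges of `F`, are few.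
-/

namespace RamseyMin

open Finset
open scoped Classical

section Splitting

section Relations

variable {α β : Type*}

theorem exists_injective_of_fractional_matching [Fintype α] [Fintype β] {R : Type*} [Semiring R]
    [PartialOrder R] [IsStrictOrderedRing R] (w : α → β → R) (hw : ∀ a b, 0 ≤ w a b)
    (hrow : ∀ a, 1 ≤ ∑ b, w a b) (hcol : ∀ b, ∑ a, w a b ≤ 1) :
    ∃ f : α → β, Function.Injective f ∧ ∀ a, w a (f a) ≠ 0 := by
  refine (Fintype.all_card_le_filter_rel_iff_exists_injective fun a b => w a b ≠ 0).1 fun A => ?_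
  set N : Finset β := {b | ∃ a ∈ A, w a b ≠ 0}
  have hsupp : ∀ a ∈ A, ∑ b, w a b = ∑ b ∈ N, w a b := fun a ha =>
    (sum_subset (subset_univ N) fun b _ hb => by
      by_contra h
      exact hb (mem_filter.2 ⟨mem_univ b, a, ha, h⟩)).symm
  have : (#A : R) ≤ #N := calc
    (#A : R) = ∑ a ∈ A, 1 := by simp
    _ ≤ ∑ a ∈ A, ∑ b ∈ N, w a b := sum_le_sum fun a ha => hsupp a ha ▸ hrow a
    _ = ∑ b ∈ N, ∑ a ∈ A, w a b := sum_comm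
    _ ≤ ∑ b ∈ N, ∑ a, w a b := sum_le_sum fun b _ =>
        sum_le_sum_of_subset_of_nonneg (subset_univ A) fun a _ _ => hw a b
    _ ≤ ∑ b ∈ N, 1 := sum_le_sum fun b _ => hcol b
    _ = #N := by simp
  exact_mod_cast this

/-- The relation `O`, seen as a bipartite graph, has maximum degree at most `d`. -/
def BoundedDegree (O : α → β → Prop) (d : ℕ) : Prop :=
  (∀ a, {b | O a b}.ncard ≤ d) ∧ ∀ b, {a | O a b}.ncard ≤ d

theorem BoundedDegree.sup {O O' : α → β → Prop} {d d' : ℕ} (hO : BoundedDegree O d)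
    (hO' : BoundedDegree O' d') : BoundedDegree (O ⊔ O') (d + d') :=
  ⟨fun a => (Set.ncard_union_le _ _).trans (add_le_add (hO.1 a) (hO'.1 a)),
    fun b => (Set.ncard_union_le _ _).trans (add_le_add (hO.2 b) (hO'.2 b))⟩

theorem ncard_sdiff_le [Finite α] {s t : Set α} {d : ℕ} (hts : t ⊆ s) (hs : s.ncard ≤ d + 1)
    (ht : s.ncard = d + 1 → t.Nonempty) : (s \ t).ncard ≤ d := by
  rw [Set.ncard_sdiff hts]
  rcases hs.lt_or_eq with h | h
  · omega
  · have := (ht h).ncard_pos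
    omega

/-- The matrix `O / d`, padded to a doubly stochastic one. -/
noncomputable def paddedMatrix (O : α → β → Prop) (d : ℕ) : α ⊕ β → β ⊕ α → ℚ
  | .inl a, .inl b => if O a b then 1 / d else 0
  | .inl a, .inr a' => if a = a' then 1 - {b | O a b}.ncard / d else 0
  | .inr b, .inl b' => if b = b' then 1 - {a | O a b}.ncard / d else 0
  | .inr b, .inr a => if O a b then 1 / d else 0

theorem BoundedDegree.paddedMatrix_nonneg {O : α → β → Prop} {d : ℕ} (hO : BoundedDegree O d)
    (hd : 0 < d) (x : α ⊕ β) (y : β ⊕ α) : 0 ≤ paddedMatrix O d x y := by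
  have hd' : (0 : ℚ) < d := by exact_mod_cast hd
  have hα : ∀ a, ({b | O a b}.ncard / d : ℚ) ≤ 1 := fun a =>
    (div_le_one hd').2 (by exact_mod_cast hO.1 a)
  have hβ : ∀ b, ({a | O a b}.ncard / d : ℚ) ≤ 1 := fun b =>
    (div_le_one hd').2 (by exact_mod_cast hO.2 b)
  rcases x with a | b <;> rcases y with b' | a' <;> simp only [paddedMatrix] <;> split_ifs <;>
    first | positivity | linarith [hα a] | linarith [hβ b]

theorem sum_paddedMatrix_row [Fintype α] [Fintype β] (O : α → β → Prop) (d : ℕ) (x : α ⊕ β) :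
    ∑ y, paddedMatrix O d x y = 1 := by
  rcases x with a | b <;>
    simp [paddedMatrix, sum_ite, div_eq_mul_inv, Set.ncard_eq_toFinset_card']

theorem sum_paddedMatrix_col [Fintype α] [Fintype β] (O : α → β → Prop) (d : ℕ) (y : β ⊕ α) :
    ∑ x, paddedMatrix O d x y = 1 := by
  rcases y with b | a <;>
    simp [paddedMatrix, sum_ite, div_eq_mul_inv, Set.ncard_eq_toFinset_card']

variable [Finite α] [Finite β]

theorem BoundedDegree.exists_partial_matching {O : α → β → Prop} {d : ℕ} (hO : BoundedDegree O d)
    (hd : 0 < d) :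
    ∃ M : α → β → Prop, M ≤ O ∧ BoundedDegree M 1 ∧
      (∀ a, {b | O a b}.ncard = d → ∃ b, M a b) ∧ ∀ b, {a | O a b}.ncard = d → ∃ a, M a b := by
  have := Fintype.ofFinite α
  have := Fintype.ofFinite β
  obtain ⟨f, hf, hne⟩ := exists_injective_of_fractional_matching (paddedMatrix O d)
    (hO.paddedMatrix_nonneg hd) (fun x => (sum_paddedMatrix_row O d x).ge)
    fun y => (sum_paddedMatrix_col O d y).le
  have hsurj : Function.Surjective f :=
    ((Fintype.bijective_iff_injective_and_card f).2 ⟨hf, by simp [add_comm]⟩).surjective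
  refine ⟨fun a b => f (.inl a) = .inl b, fun a b h => ?_, ⟨fun a => ?_, fun b => ?_⟩,
    fun a ha => ?_, fun b hb => ?_⟩
  · by_contra hab
    exact hne (.inl a) (h ▸ if_neg hab)
  · exact (Set.ncard_le_one).2 fun b hb b' hb' => Sum.inl_injective (hb.symm.trans hb')
  · exact (Set.ncard_le_one).2 fun a ha a' ha' => Sum.inl_injective (hf (ha.trans ha'.symm))
  · rcases hfa : f (.inl a) with b | a'
    · exact ⟨b, hfa⟩
    · have hslack := hne (.inl a)
      simp [paddedMatrix, hfa, ha, hd.ne'] at hslack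
  · obtain ⟨a | b', hfb⟩ := hsurj (.inl b)
    · exact ⟨a, hfb⟩
    · have hslack := hne (.inr b')
      rw [hfb] at hslack
      obtain ⟨rfl, hslack'⟩ := ite_ne_right_iff.1 hslack
      simp [hb, hd.ne'] at hslack'

theorem BoundedDegree.exists_split {O : α → β → Prop} {m n : ℕ} (hO : BoundedDegree O (m + n)) :
    ∃ P Q : α → β → Prop, O = P ⊔ Q ∧ BoundedDegree P m ∧ BoundedDegree Q n := by
  induction n generalizing O with
  | zero => exact ⟨O, ⊥, by simp, hO, by simp [BoundedDegree]⟩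
  | succ n ih =>
    obtain ⟨M, hMO, hM, hrow, hcol⟩ := hO.exists_partial_matching (by omega)
    have hdiff : BoundedDegree (O \ M) (m + n) :=
      ⟨fun a => ncard_sdiff_le (hMO a) (hO.1 a) (hrow a),
        fun b => ncard_sdiff_le (hMO · b) (hO.2 b) (hcol b)⟩
    obtain ⟨P, Q, hPQ, hP, hQ⟩ := ih hdiff
    exact ⟨P, Q ⊔ M, by rw [← sup_assoc, ← hPQ, sdiff_sup_cancel hMO], hP, hQ.sup hM⟩

end Relations

section Orientations

variable {V : Type*}

theorem degree_eq_ncard (F : SimpleGraph V) (v : V) [Fintype (F.neighborSet v)] :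
    F.degree v = (F.neighborSet v).ncard := by
  rw [← card_neighborSet_eq_degree, ← Nat.card_coe_set_eq, Nat.card_eq_fintype_card]

theorem BoundedDegree.degree_fromRel_le [Finite V] {P : V → V → Prop} {d : ℕ}
    (hP : BoundedDegree P d) (v : V) [Fintype ((fromRel P).neighborSet v)] :
    (fromRel P).degree v ≤ 2 * d := by
  rw [degree_eq_ncard, two_mul]
  calc ((fromRel P).neighborSet v).ncard
      ≤ ({w | P v w} ∪ {u | P u v}).ncard := Set.ncard_le_ncard fun w hw => hw.2
    _ ≤ {w | P v w}.ncard + {u | P u v}.ncard := Set.ncard_union_le _ _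
    _ ≤ d + d := add_le_add (hP.1 v) (hP.2 v)

/-- `O` orients every edge of `F` in exactly one direction. -/
structure IsOrientation (O : V → V → Prop) (F : SimpleGraph V) : Prop where
  adj_iff : ∀ u v, F.Adj u v ↔ O u v ∨ O v u
  asymm : ∀ u v, O u v → ¬O v u

variable [Fintype V]

theorem IsOrientation.ncard_out_add_ncard_in {F : SimpleGraph V} {O : V → V → Prop}
    (hO : IsOrientation O F) (v : V) :
    {w | O v w}.ncard + {u | O u v}.ncard = F.degree v := by
  have hunion : F.neighborSet v = {w | O v w} ∪ {u | O u v} := Set.ext (hO.adj_iff v)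
  rw [degree_eq_ncard, hunion]
  exact (Set.ncard_union_eq (Set.disjoint_left.2 fun w => hO.asymm v w)).symm

theorem sum_ncard_out_eq_sum_ncard_in (O : V → V → Prop) :
    ∑ v, {w | O v w}.ncard = ∑ v, {u | O u v}.ncard := by
  simpa [bipartiteAbove, bipartiteBelow, Set.ncard_eq_toFinset_card'] using
    sum_card_bipartiteAbove_eq_sum_card_bipartiteBelow (s := univ) (t := univ) O

theorem exists_injective_incident_slot {F : SimpleGraph V} (hF : ∀ v, Even (F.degree v)) :
    ∃ f : F.edgeSet → Σ v, Fin (F.degree v / 2), Function.Injective f ∧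
      ∀ e : F.edgeSet, (f e).1 ∈ (e : Sym2 V) := by
  let w : F.edgeSet → V → ℚ := fun e v => if v ∈ (e : Sym2 V) then 1 / F.degree v else 0
  have hw : ∀ e v, 0 ≤ w e v := fun e v => by simp only [w]; positivity
  have hdeg : ∀ (e : F.edgeSet) (v : V), v ∈ (e : Sym2 V) → (F.degree v : ℚ) ≠ 0 :=
    fun e v hv => by
      obtain ⟨u, hu⟩ := hv
      have hvu : F.Adj v u := by simpa only [hu, mem_edgeSet] using e.2
      exact Nat.cast_ne_zero.2 hvu.degree_pos_left.ne'
  have hhalf : ∀ e v, ((F.degree v / 2 : ℕ) : ℚ) * w e v =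
      if v ∈ (e : Sym2 V).toFinset then 1 / 2 else 0 := fun e v => by
    rw [Nat.cast_div (hF v).two_dvd (by norm_num), Nat.cast_ofNat]
    by_cases hv : v ∈ (e : Sym2 V)
    · have := hdeg e v hv
      simp only [w, hv, Sym2.mem_toFinset, if_true]
      field_simp
    · simp [w, hv]
  have hrow : ∀ e, ∑ x : Σ v, Fin (F.degree v / 2), w e x.1 = 1 := fun e => by
    have htwo := Sym2.card_toFinset_of_not_isDiag _ (F.not_isDiag_of_mem_edgeSet e.2)
    simp [Fintype.sum_sigma, hhalf, -Sym2.mem_toFinset, htwo]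
  have hcol : ∀ x : Σ v, Fin (F.degree v / 2), ∑ e, w e x.1 ≤ 1 := by
    rintro ⟨v, i⟩
    have hcard : #{e : F.edgeSet | v ∈ (e : Sym2 V)} = F.degree v := by
      rw [← card_incidenceFinset_eq_degree]
      exact card_bij' (fun e _ => e) (fun e he => ⟨e, by simp_all [incidenceSet]⟩)
        (by simp [incidenceSet]) (by simp [incidenceSet]) (by simp) (by simp)
    have hv : (F.degree v : ℚ) ≠ 0 := Nat.cast_ne_zero.2 (by have := i.2; omega)
    simp [w, sum_ite, hcard, hv]
  obtain ⟨f, hf, hwf⟩ := exists_injective_of_fractional_matching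
    (fun (e : F.edgeSet) (x : Σ v, Fin (F.degree v / 2)) => w e x.1) (fun e x => hw e x.1)
    (fun e => (hrow e).ge) hcol
  exact ⟨f, hf, fun e => by_contra fun h => hwf e (if_neg h)⟩

theorem exists_isOrientation_ncard_out_le {F : SimpleGraph V} (hF : ∀ v, Even (F.degree v)) :
    ∃ O, IsOrientation O F ∧ ∀ v, {w | O v w}.ncard ≤ F.degree v / 2 := by
  obtain ⟨f, hf, htail⟩ := exists_injective_incident_slot hF
  refine ⟨fun u v => ∃ h : F.Adj u v, (f ⟨s(u, v), h⟩).1 = u, ⟨fun u v => ⟨fun h => ?_, ?_⟩, ?_⟩,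
    fun v => ?_⟩
  · rcases Sym2.mem_iff.1 (htail ⟨s(u, v), h⟩) with hu | hv
    · exact .inl ⟨h, hu⟩
    · exact .inr ⟨h.symm, by simpa only [Sym2.eq_swap] using hv⟩
  · rintro (⟨h, -⟩ | ⟨h, -⟩)
    exacts [h, h.symm]
  · rintro u v ⟨h, hu⟩ ⟨h', hv⟩
    simp only [Sym2.eq_swap (a := v), hu] at hv
    exact h.ne hv
  · have hslot : ∀ w : {w | ∃ h : F.Adj v w, (f ⟨s(v, w), h⟩).1 = v},
        ∃ i, f ⟨s(v, w), w.2.1⟩ = ⟨v, i⟩ := by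
      rintro ⟨w, h, hw⟩
      obtain ⟨i, hi⟩ : f ⟨s(v, w), h⟩ ∈ Set.range (Sigma.mk v) := by simpa using hw
      exact ⟨i, hi.symm⟩
    choose i hi using hslot
    have hinj : Function.Injective i := fun w w' h => by
      have := congrArg Subtype.val (hf ((hi w).trans ((h ▸ hi w').symm)))
      exact Subtype.ext (Sym2.congr_right.1 this)
    simpa only [Nat.card_coe_set_eq, Nat.card_fin] using Nat.card_le_card_of_injective i hinj

theorem exists_isOrientation_ncard_le_of_even {F : SimpleGraph V} (hF : ∀ v, Even (F.degree v)) :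
    ∃ O, IsOrientation O F ∧ ∀ v, {w | O v w}.ncard ≤ F.degree v / 2 ∧
      {u | O u v}.ncard ≤ F.degree v / 2 := by
  obtain ⟨O, hO, hout⟩ := exists_isOrientation_ncard_out_le hF
  have hle : ∀ v, {w | O v w}.ncard ≤ {u | O u v}.ncard := fun v => by
    have := hO.ncard_out_add_ncard_in v
    have := hout v
    omega
  have heq := (sum_eq_sum_iff_of_le fun v _ => hle v).1 (sum_ncard_out_eq_sum_ncard_in O)
  exact ⟨O, hO, fun v => ⟨hout v, heq v (mem_univ v) ▸ hout v⟩⟩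

/-- `F` with a new vertex `none` joined to all vertices of odd degree. -/
def joinOddVertices (F : SimpleGraph V) : SimpleGraph (Option V) where
  Adj
    | some u, some v => F.Adj u v
    | some u, none => Odd (F.degree u)
    | none, some v => Odd (F.degree v)
    | none, none => False
  symm := ⟨by rintro (_ | u) (_ | v) h <;> first | exact h | exact F.adj_symm h⟩
  loopless := ⟨by rintro (_ | u) h <;> first | exact h | exact F.irrefl h⟩

theorem degree_joinOddVertices_some (F : SimpleGraph V) (v : V) :
    (joinOddVertices F).degree (some v) = 2 * ((F.degree v + 1) / 2) := by
  have hset : (joinOddVertices F).neighborSet (some v) =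
      some '' F.neighborSet v ∪ {x | x = none ∧ Odd (F.degree v)} := by
    ext (_ | w) <;> simp [joinOddVertices]
  have hdisj : Disjoint (some '' F.neighborSet v) {x | x = none ∧ Odd (F.degree v)} :=
    Set.disjoint_left.2 (by rintro _ ⟨w, -, rfl⟩; simp)
  have hnone : {x : Option V | x = none ∧ Odd (F.degree v)}.ncard = F.degree v % 2 := by
    rcases Nat.even_or_odd (F.degree v) with h | h
    · simp [Nat.not_odd_iff_even.2 h, Nat.even_iff.1 h]
    · simp [h, Nat.odd_iff.1 h]
  rw [degree_eq_ncard, hset, Set.ncard_union_eq hdisj,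
    Set.ncard_image_of_injective _ (Option.some_injective V), ← degree_eq_ncard, hnone]
  omega

theorem even_degree_joinOddVertices (F : SimpleGraph V) (x : Option V) :
    Even ((joinOddVertices F).degree x) := by
  rcases x with _ | v
  · have : (joinOddVertices F).neighborSet none = some '' {v | Odd (F.degree v)} := by
      ext (_ | w) <;> simp [joinOddVertices]
    rw [degree_eq_ncard, this, Set.ncard_image_of_injective _ (Option.some_injective V),
      Set.ncard_eq_toFinset_card']
    simpa using F.even_card_odd_degree_vertices
  · simp [degree_joinOddVertices_some]

theorem exists_isOrientation_ncard_le (F : SimpleGraph V) :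
    ∃ O, IsOrientation O F ∧ ∀ v, {w | O v w}.ncard ≤ (F.degree v + 1) / 2 ∧
      {u | O u v}.ncard ≤ (F.degree v + 1) / 2 := by
  obtain ⟨O, hO, hdeg⟩ := exists_isOrientation_ncard_le_of_even (even_degree_joinOddVertices F)
  simp only [Option.forall, degree_joinOddVertices_some] at hdeg
  have hrestrict : ∀ p : Option V → Prop, {w | p (some w)}.ncard ≤ {x | p x}.ncard := fun p =>
    Set.ncard_le_ncard_of_injOn some (fun _ h => h) (Option.some_injective V).injOn
  refine ⟨fun u v => O (some u) (some v), ⟨fun u v => hO.adj_iff (some u) (some v),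
    fun u v => hO.asymm (some u) (some v)⟩, fun v => ⟨?_, ?_⟩⟩
  · exact (hrestrict (O (some v))).trans (by have := hdeg.2 v; omega)
  · exact (hrestrict (O · (some v))).trans (by have := hdeg.2 v; omega)

theorem exists_sup_degree_le {F : SimpleGraph V} {m n : ℕ} (hF : ∀ v, F.degree v ≤ 2 * (m + n)) :
    ∃ R B : SimpleGraph V, F ≤ R ⊔ B ∧ (∀ v, R.degree v ≤ 2 * m) ∧ ∀ v, B.degree v ≤ 2 * n := by
  obtain ⟨O, hO, hdeg⟩ := exists_isOrientation_ncard_le F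
  have hbdd : BoundedDegree O (m + n) :=
    ⟨fun v => (hdeg v).1.trans (by have := hF v; omega),
      fun v => (hdeg v).2.trans (by have := hF v; omega)⟩
  obtain ⟨P, Q, rfl, hP, hQ⟩ := hbdd.exists_split
  refine ⟨fromRel P, fromRel Q, fun u v h => ?_, fun v => by convert hP.degree_fromRel_le v,
    fun v => by convert hQ.degree_fromRel_le v⟩
  rcases (hO.adj_iff u v).1 h with (h' | h') | (h' | h')
  exacts [.inl ⟨h.ne, .inl h'⟩, .inr ⟨h.ne, .inl h'⟩, .inl ⟨h.ne, .inr h'⟩, .inr ⟨h.ne, .inr h'⟩]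

end Orientations

end Splitting

section Copies

variable {U V W : Type*}

theorem isContained_induce_iff {K : SimpleGraph W} {X : SimpleGraph V} {s : Set V} :
    K ⊑ X.induce s ↔ ∃ f : Copy K X, ∀ w, f w ∈ s := by
  refine ⟨fun ⟨f⟩ => ⟨(Embedding.induce s).toCopy.comp f, fun w => (f w).2⟩, fun ⟨f, hf⟩ =>
    ⟨⟨⟨fun w => ⟨f w, hf w⟩, fun h => f.toHom.map_adj h⟩, fun a b h => ?_⟩⟩⟩
  exact f.injective (congrArg Subtype.val h)

theorem sum_isContained_iff {G : SimpleGraph U} {H : SimpleGraph W} {X : SimpleGraph V} :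
    (G ⊕g H) ⊑ X ↔ ∃ f : Copy G X, H ⊑ X.induce (Set.range f)ᶜ := by
  simp only [isContained_induce_iff]
  constructor
  · rintro ⟨f⟩
    refine ⟨f.comp Embedding.sumInl.toCopy, f.comp Embedding.sumInr.toCopy, ?_⟩
    rintro w ⟨u, hu⟩
    exact Sum.inl_ne_inr (f.injective hu)
  · rintro ⟨f, g, hfg⟩
    refine ⟨⟨⟨Sum.elim f g, ?_⟩, f.injective.sumElim g.injective fun u w h => hfg w ⟨u, h⟩⟩⟩
    rintro (a | a) (b | b) h
    · exact f.toHom.map_adj h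
    · simp at h
    · simp at h
    · exact g.toHom.map_adj h

theorem exists_copy_starG_iff {r : ℕ} {X : SimpleGraph V} {p : Set V → Prop} :
    (∃ f : Copy (starG r) X, p (Set.range f)) ↔
      ∃ (c : V) (A : Finset V), #A = r ∧ (∀ a ∈ A, X.Adj c a) ∧ p (insert c ↑A) := by
  constructor
  · rintro ⟨f, hf⟩
    refine ⟨f (.inl 0), univ.image fun i => f (.inr i), ?_, ?_, ?_⟩
    · have hinj : Function.Injective fun i => f (.inr i) := f.injective.comp Sum.inr_injective
      simp [card_image_of_injective _ hinj]
    · simp only [mem_image, mem_univ, true_and, forall_exists_index, forall_apply_eq_imp_iff]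
      exact fun i => f.toHom.map_adj (by simp)
    · convert hf
      ext v
      simp [Sum.exists, eq_comm]
  · rintro ⟨c, A, hA, hadj, hp⟩
    let e := (A.equivFinOfCardEq hA).symm
    have hce : ∀ i, X.Adj c (e i) := fun i => hadj _ (e i).2
    have hrange : Set.range (Sum.elim (fun _ : Fin 1 => c) fun i => (e i : V)) = insert c ↑A := by
      have : Set.range (fun i => (e i : V)) = A := by
        rw [← Function.comp_def, e.surjective.range_comp, Subtype.range_coe]
      simp [this, Set.Sum.elim_range]
    refine ⟨⟨⟨Sum.elim (fun _ => c) fun i => e i, ?_⟩, ?_⟩, hrange ▸ hp⟩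
    · rintro (i | i) (j | j) h
      · simp at h
      · exact hce j
      · exact (hce i).symm
      · simp at h
    · exact (Function.injective_of_subsingleton _).sumElim
        (Subtype.val_injective.comp e.injective) fun _ i => (hce i).ne

theorem starG_sum_isContained_iff {r : ℕ} {K : SimpleGraph W} {X : SimpleGraph V} :
    (starG r ⊕g K) ⊑ X ↔ ∃ (c : V) (A : Finset V), #A = r ∧ (∀ a ∈ A, X.Adj c a) ∧
      K ⊑ X.induce (insert c (A : Set V))ᶜ :=
  sum_isContained_iff.trans (exists_copy_starG_iff (p := fun s => K ⊑ X.induce sᶜ))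

theorem starG_isContained_induce_iff {r : ℕ} {X : SimpleGraph V} {s : Set V} :
    starG r ⊑ X.induce s ↔
      ∃ (c : V) (A : Finset V), #A = r ∧ (∀ a ∈ A, X.Adj c a) ∧ insert c ↑A ⊆ s := by
  simp only [isContained_induce_iff, ← Set.range_subset_iff]
  exact exists_copy_starG_iff (p := (· ⊆ s))

theorem starG_sum_free_of_degree_lt [Fintype V] {r : ℕ} (K : SimpleGraph W) {X : SimpleGraph V}
    (h : ∀ v, X.degree v < r) : (starG r ⊕g K).Free X := by
  rw [Free, starG_sum_isContained_iff]
  rintro ⟨c, A, hA, hadj, -⟩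
  have := card_le_card fun a ha => (X.mem_neighborFinset c a).2 (hadj a ha)
  have := h c
  rw [card_neighborFinset_eq_degree] at *
  omega

theorem starG_sum_isContained_of_le_degree [Fintype V] [Fintype W] {r : ℕ} {K : SimpleGraph W}
    {X : SimpleGraph V} {v : V} (hK : K ⊑ X.induce {v}ᶜ)
    (hv : r + Fintype.card W ≤ X.degree v) : (starG r ⊕g K) ⊑ X := by
  obtain ⟨f, hf⟩ := isContained_induce_iff.1 hK
  have hcard : r ≤ #(X.neighborFinset v \ univ.image f) := by
    have := le_card_sdiff (univ.image f) (X.neighborFinset v)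
    have := card_image_le (s := univ) (f := f)
    rw [card_neighborFinset_eq_degree, card_univ] at *
    omega
  obtain ⟨A, hA, hAcard⟩ := exists_subset_card_eq hcard
  refine starG_sum_isContained_iff.2 ⟨v, A, hAcard, fun a ha => ?_,
    isContained_induce_iff.2 ⟨f, fun w => ?_⟩⟩
  · exact (X.mem_neighborFinset v a).1 (mem_sdiff.1 (hA ha)).1
  · rintro (h | h)
    · exact hf w h
    · exact (mem_sdiff.1 (hA h)).2 (mem_image_of_mem f (mem_univ w))

theorem starG_isContained_starG {q r : ℕ} (h : q ≤ r) : starG q ⊑ starG r := by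
  refine ⟨⟨⟨Sum.map id (Fin.castLE h), ?_⟩,
    Function.injective_id.sumMap (Fin.castLE_injective h)⟩⟩
  rintro (i | i) (j | j) h <;> simp_all

/-- Moving the first edge of a matching to a separate summand. -/
def matchingGSuccIso (k : ℕ) : matchingG (k + 1) ≃g (starG 1 ⊕g matchingG k) where
  toFun p := Fin.cases (.inl (if p.2 then .inr 0 else .inl 0)) (fun i => .inr (i, p.2)) p.1
  invFun := Sum.elim (Sum.elim (fun _ => (0, false)) fun _ => (0, true)) fun p => (p.1.succ, p.2)
  left_inv := by
    rintro ⟨i, x⟩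
    induction i using Fin.cases <;> cases x <;> rfl
  right_inv := by
    rintro ((i | i) | p)
    · simp [Subsingleton.elim i 0]
    · simp [Subsingleton.elim i 0]
    · simp
  map_rel_iff' := by
    rintro ⟨i, x⟩ ⟨j, y⟩
    induction i using Fin.cases <;> induction j using Fin.cases <;> cases x <;> cases y <;>
      simp [matchingG, (Fin.succ_ne_zero _).symm]

theorem matchingG_succ_isContained_of_adj {k : ℕ} {X : SimpleGraph V} {a b : V} (hab : X.Adj a b)
    (h : matchingG k ⊑ X.induce {a, b}ᶜ) : matchingG (k + 1) ⊑ X :=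
  (matchingGSuccIso k).isContained.trans <|
    starG_sum_isContained_iff.2 ⟨a, {b}, by simp, by simpa using hab, by rwa [coe_singleton]⟩

theorem matchingG_succ_isContained_starG_sum {s : ℕ} (hs : 0 < s) (k : ℕ) :
    matchingG (k + 1) ⊑ starG s ⊕g matchingG k := by
  refine matchingG_succ_isContained_of_adj (a := .inl (.inl 0)) (b := .inl (.inr ⟨0, hs⟩))
    (by simp) ?_
  exact isContained_induce_iff.2 ⟨Embedding.sumInr.toCopy, fun w => by simp⟩

theorem matchingG_free_of_isVertexCover {k : ℕ} {X : SimpleGraph V} {Y : Finset V}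
    (hY : X.IsVertexCover Y) (hcard : #Y < k) : (matchingG k).Free X := by
  rintro ⟨f⟩
  have hmeet : ∀ i, ∃ x, f (i, x) ∈ Y := fun i => by
    rcases hY (f.toHom.map_adj (v := (i, false)) (w := (i, true)) ⟨rfl, by simp⟩) with h | h
    exacts [⟨_, h⟩, ⟨_, h⟩]
  choose x hx using hmeet
  have hinj : Function.Injective fun i => f (i, x i) := fun i j h =>
    congrArg Prod.fst (f.injective h)
  have := card_le_card_of_injOn (s := univ) _ (fun i _ => hx i) hinj.injOn
  rw [card_univ, Fintype.card_fin] at this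
  omega

theorem matchingG_isContained_or_exists_isVertexCover (X : SimpleGraph V) (k : ℕ) :
    matchingG k ⊑ X ∨ ∃ Y : Finset V, #Y ≤ 2 * k ∧ X.IsVertexCover Y := by
  induction k with
  | zero => exact .inl ⟨⟨⟨fun p => p.1.elim0, fun {p} => p.1.elim0⟩, fun p => p.1.elim0⟩⟩
  | succ k ih =>
    rcases ih with ⟨⟨f⟩⟩ | ⟨Y, hY, hcover⟩
    · by_cases h : ∃ a b, X.Adj a b ∧ a ∉ univ.image f ∧ b ∉ univ.image f
      · obtain ⟨a, b, hab, ha, hb⟩ := h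
        refine .inl (matchingG_succ_isContained_of_adj hab
          (isContained_induce_iff.2 ⟨f, fun p => ?_⟩))
        have := mem_image_of_mem f (mem_univ p)
        rintro (rfl | rfl) <;> contradiction
      · push Not at h
        refine .inr ⟨univ.image f, card_image_le.trans (by simp; omega), fun a b hab => ?_⟩
        exact or_iff_not_imp_left.2 (h a b hab)
    · exact .inr ⟨Y, by omega, hcover⟩

theorem exists_isVertexCover_of_starG_sum_matchingG_free [Fintype V] {s k : ℕ} {X : SimpleGraph V}
    {v : V} (hX : (starG s ⊕g matchingG k).Free X) (hv : s ≤ X.degree v) :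
    ∃ Y : Finset V, #Y ≤ s + 1 + 2 * k ∧ X.IsVertexCover Y := by
  obtain ⟨A, hA, hcard⟩ := exists_subset_card_eq hv
  have hmatch : ¬matchingG k ⊑ X.induce (insert v (A : Set V))ᶜ := fun h =>
    hX (starG_sum_isContained_iff.2 ⟨v, A, hcard, fun a ha => by simpa using hA ha, h⟩)
  obtain ⟨Y, hY, hcover⟩ := (matchingG_isContained_or_exists_isVertexCover _ k).resolve_left hmatch
  refine ⟨insert v A ∪ Y.map (.subtype _), ?_, fun a b hab => ?_⟩
  · have := card_union_le (insert v A) (Y.map (.subtype _))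
    have := card_insert_le v A
    rw [card_map] at *
    omega
  · by_contra hmiss
    simp only [coe_union, coe_insert, coe_map, Set.mem_union, not_or] at hmiss
    obtain ⟨⟨ha, haY⟩, hb, hbY⟩ := hmiss
    rcases hcover (v := ⟨a, ha⟩) (w := ⟨b, hb⟩) hab with h | h
    exacts [haY ⟨_, h, rfl⟩, hbY ⟨_, h, rfl⟩]

section Robust

variable {G : SimpleGraph U} {K : SimpleGraph W}

/-- `G` contains `K` even after the loss of an arbitrary vertex. -/
def IsRobustlyContained (K : SimpleGraph W) (G : SimpleGraph U) : Prop :=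
  ∀ u, K ⊑ G.induce {u}ᶜ

theorem isRobustlyContained_sum {H : SimpleGraph V} (hG : K ⊑ G) (hH : K ⊑ H) :
    IsRobustlyContained K (G ⊕g H) := by
  obtain ⟨f⟩ := hG
  obtain ⟨g⟩ := hH
  rintro (u | v)
  · exact isContained_induce_iff.2 ⟨Embedding.sumInr.toCopy.comp g, fun w => Sum.inr_ne_inl⟩
  · exact isContained_induce_iff.2 ⟨Embedding.sumInl.toCopy.comp f, fun w => Sum.inl_ne_inr⟩

theorem isRobustlyContained_matchingG_of_succ {k : ℕ} (h : matchingG (k + 1) ⊑ G) :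
    IsRobustlyContained (matchingG k) G := by
  obtain ⟨f⟩ := h
  intro u
  obtain ⟨i, hi⟩ : ∃ i, ∀ p : Fin (k + 1) × Bool, p.1 ≠ i → f p ≠ u := by
    by_cases hu : ∃ p, f p = u
    · obtain ⟨p, rfl⟩ := hu
      exact ⟨p.1, fun q hq h => hq (congrArg Prod.fst (f.injective h))⟩
    · push Not at hu
      exact ⟨0, fun p _ => hu p⟩
  let g : Copy (matchingG k) (matchingG (k + 1)) :=
    ⟨⟨Prod.map i.succAbove id, fun h => ⟨congrArg i.succAbove h.1, h.2⟩⟩,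
      i.succAbove_right_injective.prodMap Function.injective_id⟩
  exact isContained_induce_iff.2 ⟨f.comp g, fun p => hi _ (i.succAbove_ne p.1)⟩

theorem IsRobustlyContained.starG_sum_free_sup_edge [Fintype V] [Fintype W] {r : ℕ}
    {X : SimpleGraph V} {v : V} (hK : IsRobustlyContained K (starG r ⊕g K))
    (hX : (starG r ⊕g K).Free X) (hv : r + Fintype.card W ≤ X.degree v) (w : V) :
    (starG r ⊕g K).Free (X ⊔ edge v w) := by
  rintro ⟨f⟩
  refine hX (starG_sum_isContained_of_le_degree ?_ hv)
  obtain ⟨u, hu⟩ : ∃ u, ∀ u', u' ≠ u → f u' ≠ v := by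
    by_cases h : ∃ u, f u = v
    · obtain ⟨u, hu⟩ := h
      exact ⟨u, fun u' hne h' => hne (f.injective (h'.trans hu.symm))⟩
    · push Not at h
      exact ⟨.inl (.inl 0), fun u' _ => h u'⟩
  obtain ⟨g, hg⟩ := isContained_induce_iff.1 (hK u)
  have hinduce : (X ⊔ edge v w).induce {v}ᶜ = X.induce {v}ᶜ := by
    ext ⟨a, ha⟩ ⟨b, hb⟩
    have hav : a ≠ v := ha
    have hbv : b ≠ v := hb
    simp [edge_adj, hav, hbv]
  exact hinduce ▸ isContained_induce_iff.2 ⟨f.comp g, fun w => hu _ (hg w)⟩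

end Robust

end Copies

section Critical

variable {U V W : Type*} {F : SimpleGraph V} {G : SimpleGraph U} {H : SimpleGraph W}

/-- `R` and `B` are the red and the blue graph of a colouring of the edges of `F` without a red `G`
and a blue `H`; an edge may have both colours. -/
structure IsAvoidingColouring (F : SimpleGraph V) (G : SimpleGraph U) (H : SimpleGraph W)
    (R B : SimpleGraph V) : Prop where
  sup_eq : R ⊔ B = F
  red_free : G.Free R
  blue_free : H.Free B

theorem Arrows.isContained_or_isContained (h : Arrows F G H) {R B : SimpleGraph V}
    (hle : F ≤ R ⊔ B) : G ⊑ R ∨ H ⊑ B := by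
  refine (h (R ⊓ F) inf_le_right).imp (·.mono_right inf_le_left) (·.mono_right ?_)
  rwa [inf_comm, sdiff_inf_self_left, sdiff_le_iff]

theorem exists_isAvoidingColouring_of_not_arrows (h : ¬Arrows F G H) :
    ∃ R B, IsAvoidingColouring F G H R B := by
  simp only [Arrows, not_forall, not_or] at h
  obtain ⟨R, hR, hG, hH⟩ := h
  exact ⟨R, F \ R, sup_sdiff_cancel_right hR, hG, hH⟩

theorem isContained_spanningCoe_iff {s : Set V} {X : SimpleGraph s}
    (hG : ∀ u, ∃ u', G.Adj u u') : G ⊑ X.spanningCoe ↔ G ⊑ X := by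
  refine ⟨fun ⟨f⟩ => ?_, fun h => h.trans (Embedding.spanningCoe X).isContained⟩
  have hs : ∀ u, f u ∈ s := fun u => by
    obtain ⟨u', hu⟩ := hG u
    obtain ⟨-, x, -, -, hx, -⟩ := f.toHom.map_adj hu
    exact hx ▸ x.2
  rw [← induce_spanningCoe (G := X)]
  exact isContained_induce_iff.2 ⟨f, hs⟩

theorem Arrows.of_spanningCoe (hG : ∀ u, ∃ u', G.Adj u u') (hH : ∀ w, ∃ w', H.Adj w w')
    {s : Set V} {X : SimpleGraph s} (h : Arrows X.spanningCoe G H) : Arrows X G H := by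
  intro R _
  rw [← isContained_spanningCoe_iff hG, ← isContained_spanningCoe_iff hH]
  refine h.isContained_or_isContained ?_
  rintro a b ⟨hne, x, y, hxy, rfl, rfl⟩
  by_cases hRxy : R.Adj x y
  · exact .inl ⟨hne, x, y, hRxy, rfl, rfl⟩
  · exact .inr ⟨hne, x, y, ⟨hxy, hRxy⟩, rfl, rfl⟩

/-- `F → (G, H)`, but deleting any edge of `F` destroys this property, and `F` has no isolated
vertices. Every Ramsey-minimal graph has this form, and here only edges of `F` are deleted. -/
structure IsRamseyCritical (F : SimpleGraph V) (G : SimpleGraph U) (H : SimpleGraph W) : Prop where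
  arrows : Arrows F G H
  not_arrows_sdiff_edge : ∀ x y, F.Adj x y → ¬Arrows (F \ edge x y) G H
  exists_adj : ∀ x, ∃ y, F.Adj x y

theorem IsRamseyMinimal.isRamseyCritical (hF : IsRamseyMinimal F G H)
    (hG : ∀ u, ∃ u', G.Adj u u') (hH : ∀ w, ∃ w', H.Adj w w') : IsRamseyCritical F G H := by
  have hmin : ∀ F' : F.Subgraph, F' ≠ ⊤ → ¬Arrows F'.spanningCoe G H := fun F' hne h =>
    hF.2 F' hne (.of_spanningCoe hG hH (F'.spanningCoe_coe ▸ h))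
  refine ⟨hF.1, fun x y hxy => hmin (toSubgraph (F \ edge x y) sdiff_le) fun h => ?_, fun x => ?_⟩
  · have : (⊤ : F.Subgraph).Adj x y := hxy
    rw [← h] at this
    simp [edge_adj, hxy.ne] at this
  · by_contra! hx
    refine hmin ((⊤ : F.Subgraph).deleteVerts {x}) (fun h => ?_) ?_
    · have : x ∈ (⊤ : F.Subgraph).verts := Set.mem_univ x
      rw [← h] at this
      simp at this
    · convert hF.1
      ext a b
      have hne : F.Adj a b → a ≠ x ∧ b ≠ x := fun h =>
        ⟨by rintro rfl; exact hx b h, by rintro rfl; exact hx a h.symm⟩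
      simp only [Subgraph.spanningCoe_adj, Subgraph.deleteVerts_adj, Subgraph.verts_top,
        Set.mem_univ, Set.mem_singleton_iff, true_and, Subgraph.top_adj]
      exact ⟨fun h => h.2.2, fun h => ⟨(hne h).1, (hne h).2, h⟩⟩

theorem IsRamseyCritical.exists_isAvoidingColouring (hF : IsRamseyCritical F G H) {x y : V}
    (hxy : F.Adj x y) : ∃ R B, IsAvoidingColouring (F \ edge x y) G H R B :=
  exists_isAvoidingColouring_of_not_arrows (hF.not_arrows_sdiff_edge x y hxy)

namespace IsAvoidingColouring

variable {R B : SimpleGraph V} {x y : V}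

theorem red_le (h : IsAvoidingColouring (F \ edge x y) G H R B) : R ≤ F :=
  le_sup_left.trans (h.sup_eq.le.trans sdiff_le)

theorem le_sup_edge (h : IsAvoidingColouring (F \ edge x y) G H R B) :
    F ≤ R ⊔ B ⊔ edge x y :=
  sdiff_le_iff'.1 h.sup_eq.ge

theorem adj_or_adj (h : IsAvoidingColouring (F \ edge x y) G H R B) {a b : V} (hab : F.Adj a b)
    (hx : a ≠ x) (hy : a ≠ y) : R.Adj a b ∨ B.Adj a b :=
  (h.le_sup_edge hab).resolve_right fun h => by simp [edge_adj, hx, hy] at h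

theorem isContained_red_sup_edge (h : IsAvoidingColouring (F \ edge x y) G H R B)
    (hF : Arrows F G H) : G ⊑ R ⊔ edge x y :=
  (hF.isContained_or_isContained (sup_right_comm R B _ ▸ h.le_sup_edge)).resolve_right h.blue_free

theorem isContained_blue_sup_edge (h : IsAvoidingColouring (F \ edge x y) G H R B)
    (hF : Arrows F G H) : H ⊑ B ⊔ edge x y :=
  (hF.isContained_or_isContained (sup_assoc R B _ ▸ h.le_sup_edge)).resolve_left h.red_free

end IsAvoidingColouring

/-- No connected component of `G` is a single edge. -/
def NoIsolatedEdge (G : SimpleGraph V) : Prop :=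
  ∀ ⦃a b⦄, G.Adj a b → ∃ c, c ≠ a ∧ c ≠ b ∧ (G.Adj a c ∨ G.Adj b c)

theorem noIsolatedEdge_starG {r : ℕ} (hr : 2 ≤ r) : NoIsolatedEdge (starG r) := by
  have hleaf : ∀ i : Fin r, ∃ j, j ≠ i := by
    have := Fin.nontrivial_iff_two_le.2 hr
    exact exists_ne
  rintro (i | i) (j | j) h
  · simp at h
  · obtain ⟨l, hl⟩ := hleaf j
    exact ⟨.inr l, by simp, by simpa, .inl (by simp)⟩
  · obtain ⟨l, hl⟩ := hleaf i
    exact ⟨.inr l, by simpa, by simp, .inr (by simp)⟩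
  · simp at h

theorem NoIsolatedEdge.sum (hG : NoIsolatedEdge G) (hH : NoIsolatedEdge H) :
    NoIsolatedEdge (G ⊕g H) := by
  rintro (a | a) (b | b) h
  · obtain ⟨c, hca, hcb, hc⟩ := hG h
    exact ⟨.inl c, by simpa, by simpa, by simpa⟩
  · simp at h
  · simp at h
  · obtain ⟨c, hca, hcb, hc⟩ := hH h
    exact ⟨.inr c, by simpa, by simpa, by simpa⟩

theorem IsRamseyCritical.noIsolatedEdge (hF : IsRamseyCritical F G H) (hG : NoIsolatedEdge G) :
    NoIsolatedEdge F := by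
  intro x y hxy
  by_contra! hno
  obtain ⟨R, B, hRB⟩ := hF.exists_isAvoidingColouring hxy
  obtain ⟨f⟩ := hRB.isContained_red_sup_edge hF.arrows
  have hle : R ⊔ edge x y ≤ F := sup_le hRB.red_le ((edge_le_iff F).2 (.inr hxy))
  -- A copy of `G` using the isolated edge `xy` would have an isolated edge of `G` over it.
  refine hRB.red_free ⟨⟨⟨f, fun {a b} hab => (f.toHom.map_adj hab).resolve_right fun hf => ?_⟩,
    f.injective⟩⟩
  obtain ⟨c, hca, hcb, hc⟩ := hG hab
  have hc' : F.Adj (f a) (f c) ∨ F.Adj (f b) (f c) :=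
    hc.imp (fun h => hle (f.toHom.map_adj h)) fun h => hle (f.toHom.map_adj h)
  have hca' : f c ≠ f a := f.injective.ne hca
  have hcb' : f c ≠ f b := f.injective.ne hcb
  rcases ((edge_adj x y _ _).1 hf).1 with
    ⟨ha : f a = x, hb : f b = y⟩ | ⟨ha : f a = y, hb : f b = x⟩
  · simp only [ha, hb] at hca' hcb' hc'
    have := hno (f c) hca' hcb'
    tauto
  · simp only [ha, hb] at hca' hcb' hc'
    have := hno (f c) hcb' hca'
    tauto

end Critical

section Degrees

variable {U V W : Type*} {F R B : SimpleGraph V}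

theorem starG_isContained_induce_of_le_card {q : ℕ} {s : Set V} {v : V} {N : Finset V}
    (hv : v ∈ s) (hN : ∀ a ∈ N, F.Adj v a ∧ a ∈ s) (h : q ≤ #N) : starG q ⊑ F.induce s := by
  obtain ⟨A, hA, hcard⟩ := exists_subset_card_eq h
  exact starG_isContained_induce_iff.2 ⟨v, A, hcard, fun a ha => (hN a (hA ha)).1,
    Set.insert_subset hv fun a ha => (hN a (hA ha)).2⟩

variable [Fintype V]

theorem degree_le_add_degree_of_le_sup (h : F ≤ R ⊔ B) (v : V) :
    F.degree v ≤ R.degree v + B.degree v := by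
  refine (card_le_card fun w hw => ?_).trans (card_union_le (R.neighborFinset v) _)
  simpa using h ((F.mem_neighborFinset v w).1 hw)

theorem degree_le_add_one_of_le_sup_edge {x y : V} (h : F ≤ R ⊔ edge x y) (v : V) :
    F.degree v ≤ R.degree v + 1 := by
  refine (degree_le_add_degree_of_le_sup h v).trans (Nat.add_le_add_left ?_ _)
  refine card_le_one.2 fun a ha b hb => ?_
  simp only [mem_neighborFinset, edge_adj] at ha hb
  grind

theorem degree_le_of_le_sup_edge {x y v : V} (h : F ≤ R ⊔ edge x y) (hx : v ≠ x) (hy : v ≠ y) :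
    F.degree v ≤ R.degree v := by
  refine card_le_card fun a ha => ?_
  rw [mem_neighborFinset] at ha ⊢
  exact (h ha).resolve_right fun he => by simp [edge_adj, hx, hy] at he

/-- The closed neighbourhood of a set of vertices. -/
noncomputable def closedNbhd (F : SimpleGraph V) (U : Finset V) : Finset V :=
  U ∪ U.biUnion fun u => F.neighborFinset u

theorem subset_closedNbhd (F : SimpleGraph V) (U : Finset V) : U ⊆ closedNbhd F U :=
  subset_union_left

theorem mem_closedNbhd_of_adj {U : Finset V} {u v : V} (hu : u ∈ U) (h : F.Adj v u) :
    v ∈ closedNbhd F U :=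
  mem_union_right _ (mem_biUnion.2 ⟨u, hu, (F.mem_neighborFinset u v).2 h.symm⟩)

theorem card_closedNbhd_le {D : ℕ} (hF : ∀ v, F.degree v < D) (U : Finset V) :
    #(closedNbhd F U) ≤ D * #U := by
  have hD : 1 ≤ D ∨ #U = 0 := by
    rcases U.eq_empty_or_nonempty with rfl | ⟨u, -⟩
    · exact .inr card_empty
    · exact .inl (by have := hF u; omega)
  have hunion := card_biUnion_le_card_mul U (fun u => F.neighborFinset u) (D - 1)
    fun u _ => Nat.le_sub_one_of_lt (hF u)
  calc #(closedNbhd F U) ≤ #U + #U * (D - 1) := (card_union_le _ _).trans (by gcongr)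
    _ = D * #U := by
      rcases hD with h | h
      · obtain ⟨d, rfl⟩ := Nat.exists_eq_add_of_le h
        simp only [Nat.add_sub_cancel_left]
        ring
      · simp [h]

theorem card_le_of_isVertexCover {D : ℕ} (hadj : ∀ x, ∃ y, F.Adj x y) (hF : ∀ v, F.degree v < D)
    {Y : Finset V} (hY : F.IsVertexCover Y) : Fintype.card V ≤ D * #Y := by
  refine (card_le_card fun x _ => ?_).trans (card_closedNbhd_le hF Y)
  obtain ⟨y, hxy⟩ := hadj x
  exact (hY hxy).elim (fun h => subset_closedNbhd F Y h) fun h => mem_closedNbhd_of_adj h hxy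

theorem NoIsolatedEdge.starG_two_isContained_induce_compl {D : ℕ} (hedge : NoIsolatedEdge F)
    (hadj : ∀ x, ∃ y, F.Adj x y) (hF : ∀ v, F.degree v < D) {W : Finset V}
    (hV : D ^ 3 * #W < Fintype.card V) : starG 2 ⊑ F.induce (W : Set V)ᶜ := by
  let N := closedNbhd F
  have hN : ∀ {U u}, u ∉ N U → u ∉ U := fun h hu => h (subset_closedNbhd F _ hu)
  obtain ⟨z, -, hz⟩ := exists_mem_notMem_of_card_lt_card (s := N (N (N W))) (t := univ) <| calc
    #(N (N (N W))) ≤ D * (D * (D * #W)) := (card_closedNbhd_le hF _).trans <|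
      Nat.mul_le_mul_left D <| (card_closedNbhd_le hF _).trans <|
        Nat.mul_le_mul_left D (card_closedNbhd_le hF W)
    _ = D ^ 3 * #W := by ring
    _ < #univ := hV
  obtain ⟨y, hzy⟩ := hadj z
  have hy : y ∉ N (N W) := fun h => hz (mem_closedNbhd_of_adj h hzy)
  obtain ⟨x, hxz, hxy, hx⟩ := hedge hzy
  have hx' : x ∉ N W := fun h =>
    hx.elim (fun h' => hN hz (mem_closedNbhd_of_adj h h')) fun h' => hy (mem_closedNbhd_of_adj h h')
  have hzW : z ∉ W := hN (hN (hN hz))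
  have hyW : y ∉ W := hN (hN hy)
  have hxW : x ∉ W := hN hx'
  rcases hx with hx | hx
  · exact starG_isContained_induce_of_le_card (N := {y, x}) hzW (by simp [hzy, hx, hyW, hxW])
      (card_pair hxy.symm).ge
  · exact starG_isContained_induce_of_le_card (N := {z, x}) hyW (by simp [hzy.symm, hx, hzW, hxW])
      (card_pair hxz.symm).ge

section Colourings

variable {x y : V}

theorem IsAvoidingColouring.degree_le_of_ne {G : SimpleGraph U} {H : SimpleGraph W}
    (h : IsAvoidingColouring (F \ edge x y) G H R B) {v : V} (hx : v ≠ x) (hy : v ≠ y) :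
    F.degree v ≤ R.degree v + B.degree v :=
  (degree_le_of_le_sup_edge h.le_sup_edge hx hy).trans (degree_le_add_degree_of_le_sup le_rfl v)

variable [Fintype U] [Fintype W] {r s : ℕ} {K : SimpleGraph U} {L : SimpleGraph W}

/- A vertex whose red degree suffices to place the red star last absorbs one more red edge without
creating a red copy; likewise for blue. So neither colour class of a colouring of `F - vw` can have
a large degree at `v`. -/
theorem IsRamseyCritical.degree_lt (hF : IsRamseyCritical F (starG r ⊕g K) (starG s ⊕g L))
    (hK : IsRobustlyContained K (starG r ⊕g K)) (hL : IsRobustlyContained L (starG s ⊕g L))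
    (v : V) : F.degree v < r + Fintype.card U + s + Fintype.card W := by
  obtain ⟨w, hvw⟩ := hF.exists_adj v
  obtain ⟨R, B, hRB⟩ := hF.exists_isAvoidingColouring hvw
  have hR : R.degree v < r + Fintype.card U := lt_of_not_ge fun h =>
    hK.starG_sum_free_sup_edge hRB.red_free h w (hRB.isContained_red_sup_edge hF.arrows)
  have hB : B.degree v < s + Fintype.card W := lt_of_not_ge fun h =>
    hL.starG_sum_free_sup_edge hRB.blue_free h w (hRB.isContained_blue_sup_edge hF.arrows)
  have := degree_le_add_one_of_le_sup_edge hRB.le_sup_edge v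
  have := degree_le_add_degree_of_le_sup (le_refl (R ⊔ B)) v
  omega

end Colourings

end Degrees

section Finiteness

variable {U V W : Type*} [Fintype V] {F R B : SimpleGraph V} {r s k : ℕ}

theorem Arrows.exists_le_degree {K : SimpleGraph U} {L : SimpleGraph W} (hr : Odd r) (hs : Odd s)
    (hF : Arrows F (starG r ⊕g K) (starG s ⊕g L)) : ∃ x, r + s - 1 ≤ F.degree x := by
  by_contra! hdeg
  obtain ⟨m, rfl⟩ := hr
  obtain ⟨n, rfl⟩ := hs
  obtain ⟨R, B, hle, hR, hB⟩ := exists_sup_degree_le (F := F) (m := m) (n := n)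
    fun v => by have := hdeg v; omega
  exact (hF.isContained_or_isContained hle).elim
    (starG_sum_free_of_degree_lt K fun v => Nat.lt_succ_of_le (hR v))
    (starG_sum_free_of_degree_lt L fun v => Nat.lt_succ_of_le (hB v))

/-- The vertices of degree at least `r`, that is, the possible centres of a copy of `S(r)`. -/
noncomputable def highVerts (F : SimpleGraph V) (r : ℕ) : Finset V :=
  {v | r ≤ F.degree v}

theorem mem_highVerts {v : V} : v ∈ highVerts F r ↔ r ≤ F.degree v := by
  simp [highVerts]

/- Colour red the edges between vertices of degree less than `r`. There is no red `S(r)`, and the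
vertices of degree at least `r` cover the blue edges. -/
theorem Arrows.le_card_highVerts {K : SimpleGraph U} {H : SimpleGraph W} (hr : 0 < r)
    (hF : Arrows F (starG r ⊕g K) H) (hH : matchingG k ⊑ H) : k ≤ #(highVerts F r) := by
  by_contra! hcard
  obtain ⟨R, hR_adj⟩ : ∃ R : SimpleGraph V, ∀ v w,
      R.Adj v w ↔ F.Adj v w ∧ v ∉ highVerts F r ∧ w ∉ highVerts F r :=
    ⟨(F.induce (highVerts F r : Set V)ᶜ).spanningCoe, by simp⟩
  have hR : ∀ v, R.degree v < r := fun v => by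
    by_cases hv : v ∈ highVerts F r
    · rwa [show R.degree v = 0 from
        card_eq_zero.2 (eq_empty_of_forall_notMem fun w hw => by simp_all)]
    · exact (degree_le_of_le (fun _ _ h => ((hR_adj _ _).1 h).1)).trans_lt
        (by simpa [mem_highVerts] using hv)
  have hB : (F \ R).IsVertexCover (highVerts F r : Set V) := fun v w h => by
    by_contra! hvw
    exact h.2 ((hR_adj v w).2 ⟨h.1, hvw⟩)
  exact (hF.isContained_or_isContained le_sup_sdiff).elim (starG_sum_free_of_degree_lt K hR)
    fun h => matchingG_free_of_isVertexCover hB hcard (hH.trans h)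

theorem starG_isContained_induce_of_card_lt_degree {t : ℕ} {v w : V} (hwv : w ≠ v)
    (ht : t < R.degree w) : starG t ⊑ R.induce {v}ᶜ := by
  refine starG_isContained_induce_of_le_card (N := (R.neighborFinset w).erase v) hwv
    (fun a ha => ?_) ((Nat.le_sub_one_of_lt ht).trans pred_card_le_card_erase)
  have := mem_erase.1 ha
  exact ⟨(R.mem_neighborFinset w a).1 this.2, this.1⟩

theorem card_le_of_starG_sum_starG_free {t : ℕ} (hR : (starG r ⊕g starG t).Free R) {c : V}
    (hc : r ≤ R.degree c) {Q : Finset V} (hQ : ∀ q ∈ Q, t < R.degree q) :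
    #Q ≤ (r + t + 1) * (r + 1) := by
  by_cases hbig : ∃ v, r + (1 + t) ≤ R.degree v
  · obtain ⟨v, hv⟩ := hbig
    have hQv : Q ⊆ {v} := fun q hq => by
      by_contra hne
      exact hR (starG_sum_isContained_of_le_degree
        (starG_isContained_induce_of_card_lt_degree (by simpa using hne) (hQ q hq)) (by simpa))
    exact (card_le_card hQv).trans (Nat.mul_pos (by omega : 0 < r + t + 1) r.succ_pos)
  · push Not at hbig
    obtain ⟨A, hA, hcard⟩ := exists_subset_card_eq hc
    have hfree : ¬starG t ⊑ R.induce (insert c (A : Set V))ᶜ := fun h => hR <|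
      starG_sum_isContained_iff.2 ⟨c, A, hcard, fun a ha => (R.mem_neighborFinset c a).1 (hA ha), h⟩
    have hQA : Q ⊆ closedNbhd R (insert c A) := fun q hq => by
      by_contra hout
      refine hfree (starG_isContained_induce_of_le_card (v := q) (N := R.neighborFinset q) ?_
        (fun a ha => ?_) (hQ q hq).le)
      · exact fun h => hout (subset_closedNbhd R _ (by simpa using h))
      · rw [mem_neighborFinset] at ha
        exact ⟨ha, fun h => hout (mem_closedNbhd_of_adj (by simpa using h) ha)⟩
    calc #Q ≤ (r + t + 1) * #(insert c A) :=
          (card_le_card hQA).trans (card_closedNbhd_le (fun v => by have := hbig v; omega) _)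
      _ ≤ (r + t + 1) * (r + 1) := by
          gcongr
          exact (card_insert_le c A).trans (by rw [hcard])

namespace IsRamseyCritical

theorem degree_lt_of_matchingG
    (hF : IsRamseyCritical F (starG r ⊕g starG 2) (starG s ⊕g matchingG k)) (hr : 2 ≤ r)
    (hs : 0 < s) (v : V) : F.degree v < r + s + 2 * k + 4 := by
  have := hF.degree_lt (isRobustlyContained_sum (starG_isContained_starG hr) .rfl)
    (isRobustlyContained_matchingG_of_succ (matchingG_succ_isContained_starG_sum hs k)) v
  simp only [Fintype.card_sum, Fintype.card_fin, Fintype.card_prod, Fintype.card_bool] at this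
  omega

variable {x y : V}

theorem starG_two_isContained_induce_compl
    (hF : IsRamseyCritical F (starG r ⊕g starG 2) (starG s ⊕g matchingG k)) (hr : 2 ≤ r)
    (hs : 0 < s) (hV : (r + s + 2 * k + 4) ^ 4 < Fintype.card V) {W : Finset V}
    (hW : #W ≤ r + s + 2 * k + 4) : starG 2 ⊑ F.induce (W : Set V)ᶜ := by
  have hedge : NoIsolatedEdge F :=
    hF.noIsolatedEdge ((noIsolatedEdge_starG hr).sum (noIsolatedEdge_starG le_rfl))
  refine hedge.starG_two_isContained_induce_compl hF.exists_adj (hF.degree_lt_of_matchingG hr hs)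
    (lt_of_le_of_lt ?_ hV)
  rw [pow_succ _ 3]
  gcongr

/- If there were a vertex of blue degree `s`, a small set would cover all blue edges; since the
graph is large, far away from that set and from a red `S(r)` there would be a red `S(2)`. -/
theorem blue_degree_lt
    (hF : IsRamseyCritical F (starG r ⊕g starG 2) (starG s ⊕g matchingG k)) (hr : 2 ≤ r)
    (hs : 0 < s) (hV : (r + s + 2 * k + 4) ^ 4 < Fintype.card V)
    (hRB : IsAvoidingColouring (F \ edge x y) (starG r ⊕g starG 2) (starG s ⊕g matchingG k) R B)
    {c : V} (hc : r ≤ R.degree c) (v : V) : B.degree v < s := by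
  by_contra! hv
  obtain ⟨Y, hYcard, hY⟩ := exists_isVertexCover_of_starG_sum_matchingG_free hRB.blue_free hv
  obtain ⟨A, hA, hAcard⟩ := exists_subset_card_eq hc
  have hW : #({x, y} ∪ (insert c A ∪ Y)) ≤ r + s + 2 * k + 4 := by
    have := card_union_le {x, y} (insert c A ∪ Y)
    have := card_union_le (insert c A) Y
    have := card_insert_le c A
    have := card_le_two (a := x) (b := y)
    omega
  obtain ⟨z, N, hN, hzN, hsub⟩ := starG_isContained_induce_iff.1
    (hF.starG_two_isContained_induce_compl hr hs hV hW)
  have hnot : ∀ {a}, a ∈ insert z (N : Set V) → a ≠ c ∧ a ≠ x ∧ a ≠ y ∧ a ∉ A ∧ a ∉ Y :=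
    fun ha => by simpa using hsub ha
  obtain ⟨-, hzx, hzy, -, hzY⟩ := hnot (Set.mem_insert z _)
  refine hRB.red_free (starG_sum_isContained_iff.2 ⟨c, A, hAcard,
    fun a ha => (R.mem_neighborFinset c a).1 (hA ha),
    starG_isContained_induce_iff.2 ⟨z, N, hN, fun a ha => ?_, fun a ha => ?_⟩⟩)
  · exact (hRB.adj_or_adj (hzN a ha) hzx hzy).resolve_right fun h =>
      (hY h).elim hzY (hnot (Set.mem_insert_of_mem z ha)).2.2.2.2
  · obtain ⟨hac, -, -, haA, -⟩ := hnot ha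
    simp [hac, haA]

theorem red_degree_lt
    (hF : IsRamseyCritical F (starG r ⊕g starG 2) (starG s ⊕g matchingG k)) (hs : 0 < s)
    (hsr : s + 2 ≤ r) (hk : (r + 3) * (r + 1) + 2 ≤ k)
    (hV : (r + s + 2 * k + 4) ^ 4 < Fintype.card V)
    (hRB : IsAvoidingColouring (F \ edge x y) (starG r ⊕g starG 2) (starG s ⊕g matchingG k) R B)
    (c : V) : R.degree c < r := by
  by_contra! hc
  have hB := hF.blue_degree_lt (by omega) hs hV hRB hc
  have hQ : ∀ q ∈ highVerts F r \ {x, y}, 2 < R.degree q := fun q hq => by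
    simp only [mem_sdiff, mem_highVerts, mem_insert, mem_singleton, not_or] at hq
    have := hRB.degree_le_of_ne hq.2.1 hq.2.2
    have := hB q
    omega
  have hlower : k + 1 ≤ #(highVerts F r) :=
    hF.arrows.le_card_highVerts (by omega) (matchingG_succ_isContained_starG_sum hs k)
  have hupper : _ ≤ (r + 3) * (r + 1) := card_le_of_starG_sum_starG_free hRB.red_free hc hQ
  have := card_le_card_sdiff_add_card (s := highVerts F r) (t := {x, y})
  have := card_le_two (a := x) (b := y)
  omega

theorem isVertexCover_highVerts
    (hF : IsRamseyCritical F (starG r ⊕g starG 2) (starG s ⊕g matchingG k)) (hs : 0 < s)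
    (hsr : s + 2 ≤ r) (hk : (r + 3) * (r + 1) + 2 ≤ k)
    (hV : (r + s + 2 * k + 4) ^ 4 < Fintype.card V) :
    F.IsVertexCover (highVerts F r : Set V) := by
  intro x y hxy
  by_contra! hlow
  simp only [mem_coe, mem_highVerts, not_le] at hlow
  obtain ⟨R, B, hRB⟩ := hF.exists_isAvoidingColouring hxy
  refine starG_sum_free_of_degree_lt (starG 2) (fun v => ?_)
    (hRB.isContained_red_sup_edge hF.arrows)
  have hle : R ⊔ edge x y ≤ F := sup_le hRB.red_le ((edge_le_iff F).2 (.inr hxy))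
  by_cases hv : v = x ∨ v = y
  · suffices h : F.degree v < r by convert Nat.lt_of_le_of_lt (degree_le_of_le hle) h
    rcases hv with rfl | rfl
    exacts [hlow.1, hlow.2]
  · push Not at hv
    exact (degree_le_of_le_sup_edge le_rfl hv.1 hv.2).trans_lt
      (hF.red_degree_lt hs hsr hk hV hRB v)

theorem card_highVerts_le
    (hF : IsRamseyCritical F (starG r ⊕g starG 2) (starG s ⊕g matchingG k)) (hr : Odd r)
    (hs : Odd s) (hsr : s + 2 ≤ r) (hk : (r + 3) * (r + 1) + 2 ≤ k)
    (hV : (r + s + 2 * k + 4) ^ 4 < Fintype.card V) :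
    #(highVerts F r) ≤ (r + s + 2 * k + 4) ^ 2 := by
  obtain ⟨v, hv⟩ := hF.arrows.exists_le_degree hr hs
  obtain ⟨x, N, hN, hxN, hsub⟩ := starG_isContained_induce_iff.1
    (hF.starG_two_isContained_induce_compl (W := {v}) (by omega) hs.pos hV (by simp))
  obtain ⟨y, hy⟩ := card_pos.1 (hN.symm ▸ two_pos)
  have hvx : v ≠ x := fun h => hsub (Set.mem_insert x _) (by simp [h])
  have hvy : v ≠ y := fun h => hsub (Set.mem_insert_of_mem x hy) (by simp [h])
  obtain ⟨R, B, hRB⟩ := hF.exists_isAvoidingColouring (hxN y hy)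
  have hR := hF.red_degree_lt hs.pos hsr hk hV hRB
  have hBv : s ≤ B.degree v := by
    have := hRB.degree_le_of_ne hvx hvy
    have := hR v
    omega
  obtain ⟨Y, hYcard, hY⟩ := exists_isVertexCover_of_starG_sum_matchingG_free hRB.blue_free hBv
  have hhigh : highVerts F r ⊆ closedNbhd F Y ∪ {x, y} := fun q hq => by
    by_contra hout
    simp only [mem_union, mem_insert, mem_singleton, not_or] at hout
    obtain ⟨hqY, hqx, hqy⟩ := hout
    have : F.degree q ≤ R.degree q := card_le_card fun a ha => by
      rw [mem_neighborFinset] at ha ⊢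
      exact (hRB.adj_or_adj ha hqx hqy).resolve_right fun h =>
        (hY h).elim (fun h => hqY (subset_closedNbhd F Y h)) fun h =>
          hqY (mem_closedNbhd_of_adj h ha)
    have := hR q
    have := mem_highVerts.1 hq
    omega
  calc #(highVerts F r) ≤ #(closedNbhd F Y) + #{x, y} :=
        (card_le_card hhigh).trans (card_union_le _ _)
    _ ≤ (r + s + 2 * k + 4) * (s + 1 + 2 * k) + 2 := by
        gcongr
        · refine (card_closedNbhd_le (hF.degree_lt_of_matchingG (by omega) hs.pos) Y).trans ?_
          gcongr
        · exact card_le_two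
    _ ≤ (r + s + 2 * k + 4) * (s + 1 + 2 * k) + (r + s + 2 * k + 4) :=
        Nat.add_le_add_left (by omega) _
    _ = (r + s + 2 * k + 4) * (s + 1 + 2 * k + 1) := rfl
    _ ≤ (r + s + 2 * k + 4) ^ 2 := by rw [sq]; exact Nat.mul_le_mul_left _ (by omega)

theorem card_le (hF : IsRamseyCritical F (starG r ⊕g starG 2) (starG s ⊕g matchingG k))
    (hr : Odd r) (hs : Odd s) (hsr : s + 2 ≤ r) (hk : (r + 3) * (r + 1) + 2 ≤ k) :
    Fintype.card V ≤ (r + s + 2 * k + 4) ^ 4 := by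
  by_contra! hV
  have hcover := card_le_of_isVertexCover hF.exists_adj
    (hF.degree_lt_of_matchingG (by omega) hs.pos)
    (hF.isVertexCover_highVerts hs.pos hsr hk hV)
  have hhigh := hF.card_highVerts_le hr hs hsr hk hV
  refine hV.not_ge (hcover.trans ?_)
  calc (r + s + 2 * k + 4) * #(highVerts F r)
      ≤ (r + s + 2 * k + 4) * (r + s + 2 * k + 4) ^ 2 := by gcongr
    _ = (r + s + 2 * k + 4) ^ 3 := (pow_succ' _ 2).symm
    _ ≤ (r + s + 2 * k + 4) ^ 4 := Nat.pow_le_pow_right (by omega) (by norm_num)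

end IsRamseyCritical

end Finiteness

theorem ramseyFinite_of_card_le {V W : Type*} {G : SimpleGraph V} {H : SimpleGraph W} (N : ℕ)
    (h : ∀ (n : ℕ) (F : SimpleGraph (Fin n)), IsRamseyMinimal F G H → n ≤ N) :
    RamseyFinite G H := by
  refine (Set.finite_range fun p : Σ n : Fin (N + 1), SimpleGraph (Fin n) =>
    GraphClass.mk p.2).subset ?_
  rintro _ ⟨n, F, hF, rfl⟩
  exact ⟨⟨⟨n, Nat.lt_succ_of_le (h n F hF)⟩, F⟩, rfl⟩

section Targets

variable {V W : Type*} {G : SimpleGraph V} {H : SimpleGraph W} {r t q : ℕ}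

theorem exists_starG_adj (hr : 0 < r) (v : Fin 1 ⊕ Fin r) : ∃ w, (starG r).Adj v w := by
  rcases v with i | i
  · exact ⟨.inr ⟨0, hr⟩, by simp⟩
  · exact ⟨.inl 0, by simp⟩

theorem exists_matchingG_adj (p : Fin q × Bool) : ∃ p', (matchingG q).Adj p p' :=
  ⟨(p.1, !p.2), rfl, by simp⟩

theorem exists_sum_adj (hG : ∀ v, ∃ v', G.Adj v v') (hH : ∀ w, ∃ w', H.Adj w w') (u : V ⊕ W) :
    ∃ u', (G ⊕g H).Adj u u' := by
  rcases u with v | w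
  · obtain ⟨v', hv⟩ := hG v
    exact ⟨.inl v', by simpa⟩
  · obtain ⟨w', hw⟩ := hH w
    exact ⟨.inr w', by simpa⟩

theorem isTarget_of_exists_adj [Nonempty V] (hG : ∀ v, ∃ w, G.Adj v w) : IsTarget G := by
  refine ⟨?_, hG⟩
  rintro rfl
  simpa using hG (Classical.arbitrary V)

theorem ramseyFinite_starG_sum_starG_matchingG {s k : ℕ} (hr : Odd r) (hs : Odd s)
    (hsr : s + 2 ≤ r) (hk : (r + 3) * (r + 1) + 2 ≤ k) :
    RamseyFinite (starG r ⊕g starG 2) (starG s ⊕g matchingG k) := by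
  refine ramseyFinite_of_card_le ((r + s + 2 * k + 4) ^ 4) fun n F hF => ?_
  have hcrit := hF.isRamseyCritical
    (exists_sum_adj (exists_starG_adj hr.pos) (exists_starG_adj two_pos))
    (exists_sum_adj (exists_starG_adj hs.pos) exists_matchingG_adj)
  simpa using hcrit.card_le hr hs hsr hk

theorem matchingG_eq_of_adj {a b c : Fin q × Bool} (hb : (matchingG q).Adj a b)
    (hc : (matchingG q).Adj a c) : b = c :=
  Prod.ext (hb.1.symm.trans hc.1) ((Bool.eq_not_of_ne hb.2.symm).trans
    (Bool.eq_not_of_ne hc.2.symm).symm)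

theorem IsMatchingGraph.eq_of_adj (hG : IsMatchingGraph G) {a b c : V} (hb : G.Adj a b)
    (hc : G.Adj a c) : b = c := by
  obtain ⟨j, ⟨e⟩⟩ := hG
  exact e.injective (matchingG_eq_of_adj (e.map_rel_iff.2 hb) (e.map_rel_iff.2 hc))

theorem eq_center_of_starG_sum_matchingG_adj {a b c : (Fin 1 ⊕ Fin r) ⊕ (Fin q × Bool)}
    (hb : (starG r ⊕g matchingG q).Adj a b) (hc : (starG r ⊕g matchingG q).Adj a c)
    (hbc : b ≠ c) : a = .inl (.inl 0) := by
  rcases a with (i | i) | a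
  · rw [Subsingleton.elim i 0]
  · have hleaf : ∀ {d}, (starG r ⊕g matchingG q).Adj (.inl (.inr i)) d → d = .inl (.inl 0) := by
      rintro ((j | j) | d) h
      · rw [Subsingleton.elim j 0]
      all_goals simp at h
    exact absurd ((hleaf hb).trans (hleaf hc).symm) hbc
  · rcases b with b | b <;> rcases c with c | c
    case inr.inr => exact absurd (congrArg Sum.inr (matchingG_eq_of_adj hb hc)) hbc
    all_goals simp at hb hc

theorem IsStarUnionMatching.eq_of_adj (hG : IsStarUnionMatching G r q) {a b c a' b' c' : V}
    (hb : G.Adj a b) (hc : G.Adj a c) (hbc : b ≠ c) (hb' : G.Adj a' b') (hc' : G.Adj a' c')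
    (hbc' : b' ≠ c') : a = a' := by
  obtain ⟨e⟩ := hG
  have hcenter : ∀ {u v w}, G.Adj u v → G.Adj u w → v ≠ w → e u = .inl (.inl 0) :=
    fun hv hw hvw => eq_center_of_starG_sum_matchingG_adj (e.map_rel_iff.2 hv)
      (e.map_rel_iff.2 hw) (e.injective.ne hvw)
  exact e.injective ((hcenter hb hc hbc).trans (hcenter hb' hc' hbc').symm)

theorem not_isMatchingGraph_starG_sum (hr : 2 ≤ r) (H : SimpleGraph W) :
    ¬IsMatchingGraph (starG r ⊕g H) := fun h => by
  have := h.eq_of_adj (a := .inl (.inl 0)) (b := .inl (.inr ⟨0, by omega⟩))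
    (c := .inl (.inr ⟨1, by omega⟩)) (by simp) (by simp)
  simp at this

theorem not_isStarUnionMatching_starG_sum_starG {p : ℕ} (hr : 2 ≤ r) (ht : 2 ≤ t) :
    ¬IsStarUnionMatching (starG r ⊕g starG t) p q := fun h => by
  have := h.eq_of_adj
    (a := .inl (.inl 0)) (b := .inl (.inr ⟨0, by omega⟩)) (c := .inl (.inr ⟨1, by omega⟩))
    (a' := .inr (.inl 0)) (b' := .inr (.inr ⟨0, by omega⟩)) (c' := .inr (.inr ⟨1, by omega⟩))
    (by simp) (by simp) (by simp) (by simp) (by simp) (by simp)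
  simp at this

end Targets

end RamseyMin

open RamseyMin

theorem mainTheorem4_general {r s k : ℕ} (hr : Odd r) (hs : Odd s) (hs1 : 1 < s) (hsr : s < r)
    (hk : (r + 3) * (r + 1) + 2 ≤ k) :
    RamseyFinite (starG r ⊕g starG 2) (starG s ⊕g matchingG k) ∧
      ¬IsMatchingGraph (starG r ⊕g starG 2) ∧
      ¬IsMatchingGraph (starG s ⊕g matchingG k) ∧
      (¬∃ p q : ℕ, IsStarUnionMatching (starG r ⊕g starG 2) p q) ∧
      ¬BurrConjecture := by
  have hsr' : s + 2 ≤ r := by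
    obtain ⟨m, rfl⟩ := hr
    obtain ⟨n, rfl⟩ := hs
    omega
  have hfin := ramseyFinite_starG_sum_starG_matchingG hr hs hsr' hk
  have hG := not_isMatchingGraph_starG_sum (by omega : 2 ≤ r) (starG 2)
  have hH := not_isMatchingGraph_starG_sum hs1 (matchingG k)
  have hstar : ¬∃ p q : ℕ, IsStarUnionMatching (starG r ⊕g starG 2) p q := fun ⟨p, q, h⟩ =>
    not_isStarUnionMatching_starG_sum_starG (by omega) le_rfl h
  refine ⟨hfin, hG, hH, hstar, fun hBurr => ?_⟩
  have htargetG : IsTarget (starG r ⊕g starG 2) :=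
    isTarget_of_exists_adj (exists_sum_adj (exists_starG_adj hr.pos) (exists_starG_adj two_pos))
  have htargetH : IsTarget (starG s ⊕g matchingG k) :=
    isTarget_of_exists_adj (exists_sum_adj (exists_starG_adj hs.pos) exists_matchingG_adj)
  rcases (hBurr _ _ _ _ htargetG htargetH).1 hfin with (h | h) | ⟨⟨p, q, -, h⟩, -⟩
  · exact hG h
  · exact hH h
  · exact hstar ⟨p, q, h⟩

theorem mainTheorem4 :
    RamseyMin.RamseyFinite
        (RamseyMin.starG 5 ⊕g RamseyMin.starG 2) (RamseyMin.starG 3 ⊕g RamseyMin.matchingG 122) ∧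
      ¬ RamseyMin.IsMatchingGraph (RamseyMin.starG 5 ⊕g RamseyMin.starG 2) ∧
      ¬ RamseyMin.IsMatchingGraph (RamseyMin.starG 3 ⊕g RamseyMin.matchingG 122) ∧
      (¬ ∃ r q : ℕ, RamseyMin.IsStarUnionMatching (RamseyMin.starG 5 ⊕g RamseyMin.starG 2) r q) ∧
      ¬ RamseyMin.BurrConjecture := by
  exact mainTheorem4_general (by decide) (by decide) (by norm_num) (by norm_num) (by norm_num)
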